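/- All graphs are finite and simple. For a graph $G$ and $f:V(G)\to\mathbb N$, $G$ is $f$-choosable (and $f$ is a choice function for $G$, of size $\sum_v f(v)$) if for every assignment of lists $L(v)\subset\mathbb N$ with $|L(v)|=f(v)$ there is a proper coloring $c$ of $G$ with $c(v)\in L(v)$ for all $v$. The sum choice number $\chi_{SC}(G)$ is the minimum size of a choice function for $G$; the greedy bound is $GB(G)=|V(G)|+|E(G)|$; $G$ is sc-greedy if $\chi_{SC}(G)=GB(G)$. $W_4$ is the wheel on five vertices and $BW_4$ is $W_4$ with one rim edge deleted. Theorem. Let $G$ be a graph on five vertices. (1) If $G$ is disconnected, or if $G$ has a cut vertex, then $G$ is sc-greedy. (2) $G$ is connected without a cut vertex if and only if it is isomorphic to one of the following ten graphs, and then to exactly one of them; their sum choice numbers and greedy bounds are as listed: - $G5.1=C_5$: $\chi_{SC}=10$, $GB=10$; - $G5.2=K_{2,3}$: $\chi_{SC}=10$, $GB=11$; - $G5.3=\Theta_{0,1,2}$ ($C_5$ plus one chord): $\chi_{SC}=11$, $GB=11$; - $G5.4$, with vertices $v_1,\dots,v_5$ and edges $v_1v_2,v_1v_5,v_2v_3,v_2v_4,v_5v_3,v_5v_4,v_3v_4$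 ($K_{2,3}$ plus an edge inside the part of size three): $\chi_{SC}=11$, $GB=12$; - $G5.5=K_{1,1,3}$ ($K_{2,3}$ plus the edge inside the part of size two): $\chi_{SC}=12$, $GB=12$; - $G5.6=BW_4$: $\chi_{SC}=12$, $GB=12$; - $G5.7$, which is $K_5$ minus two adjacent edges: $\chi_{SC}=13$, $GB=13$; - $G5.8=W_4$: $\chi_{SC}=12$, $GB=13$; - $G5.9$, which is $K_5$ minus one edge: $\chi_{SC}=14$, $GB=14$; - $K_5$: $\chi_{SC}=15$, $GB=15$. (3) $G$ is not sc-greedy if and only if it is isomorphic to $K_{2,3}$, $G5.4$ or $W_4$. (4) $f(v_3)=3$, $f(v_1)=f(v_2)=f(v_4)=f(v_5)=2$ is a choice function (of size $11$) for $G5.4$; and the function with value $3$ on the hub and on one rim vertex and value $2$ on the other three rim vertices is a choice function (of size $12$) for $W_4$. -/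

import Mathlib

namespace SumChoice

variable {V : Type*}

/-- `G` is `f`-choosable: for every assignment of lists of colors (natural numbers) with
`|L v| = f v` for all `v` there is a proper coloring of `G` choosing each color from its list. -/
def IsChoosable (G : SimpleGraph V) (f : V → ℕ) : Prop :=
  ∀ L : V → Finset ℕ, (∀ v, (L v).card = f v) → ∃ c : G.Coloring ℕ, ∀ v, c v ∈ L v

/-- The sum choice number: the minimum of `∑ v, f v` over all choice functions `f` for `G`. -/
noncomputable def sumChoiceNumber [Fintype V] (G : SimpleGraph V) : ℕ :=
  sInf {m | ∃ f : V → ℕ, IsChoosable G f ∧ ∑ v, f v = m}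

/-- The greedy bound `|V(G)| + |E(G)|`. -/
noncomputable def greedyBound [Fintype V] (G : SimpleGraph V) : ℕ :=
  Fintype.card V + G.edgeSet.ncard

/-- `G` is sc-greedy if its sum choice number equals the greedy bound. -/
def IsSCGreedy [Fintype V] (G : SimpleGraph V) : Prop :=
  sumChoiceNumber G = greedyBound G

/-- `v` is a cut vertex of `G`: deleting `v` disconnects two other vertices that are joined by a
path in `G` (that is, `G - v` has more connected components than `G`). -/
def IsCutVertex (G : SimpleGraph V) (v : V) : Prop :=
  ∃ (u w : V) (hu : u ≠ v) (hw : w ≠ v),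
    G.Reachable u w ∧ ¬ (G.induce {x | x ≠ v}).Reachable ⟨u, hu⟩ ⟨w, hw⟩

/-- The join of a graph `H` with one new vertex `none`, adjacent to all vertices of `H`. -/
def cone (H : SimpleGraph V) : SimpleGraph (Option V) :=
  SimpleGraph.fromRel fun x y => x = none ∨ ∃ a b, x = some a ∧ y = some b ∧ H.Adj a b

/-- The wheel `W_k`, on `k + 1` vertices (for `3 ≤ k`). -/
def wheelGraph (k : ℕ) : SimpleGraph (Option (Fin k)) := cone (SimpleGraph.cycleGraph k)

/-- The broken wheel `BW_k`, on `k + 1` vertices. -/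
def brokenWheelGraph (k : ℕ) : SimpleGraph (Option (Fin k)) := cone (SimpleGraph.pathGraph k)

/-- The graphs on five vertices that are connected and have no cut vertex.
The index `i` is that of the graph `G5.(i+1)`; the last one is the complete graph. -/
def graphFive : Fin 10 → SimpleGraph (Fin 5) :=
  ![
    -- the cycle on five vertices
    SimpleGraph.cycleGraph 5,
    -- the complete bipartite graph with parts {0, 1} and {2, 3, 4}
    SimpleGraph.fromEdgeSet {s(0, 2), s(0, 3), s(0, 4), s(1, 2), s(1, 3), s(1, 4)},
    -- the theta graph with 0, 1 and 2 internal vertices: paths 0-1, 0-2-1, 0-3-4-1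
    SimpleGraph.fromEdgeSet {s(0, 1), s(0, 2), s(2, 1), s(0, 3), s(3, 4), s(4, 1)},
    -- the complete bipartite graph with parts {1, 4} and {0, 2, 3}, plus the edge 2-3;
    -- equivalently, the complete graph on {1, 2, 3, 4} with its edge 1-4 subdivided by 0
    SimpleGraph.fromEdgeSet
      {s(0, 1), s(0, 4), s(1, 2), s(1, 3), s(4, 2), s(4, 3), s(2, 3)},
    -- the complete bipartite graph with parts {0, 1} and {2, 3, 4}, plus the edge 0-1
    SimpleGraph.fromEdgeSet
      {s(0, 2), s(0, 3), s(0, 4), s(1, 2), s(1, 3), s(1, 4), s(0, 1)},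
    -- the broken wheel with hub 0 and path 1-2-3-4
    SimpleGraph.fromEdgeSet
      {s(0, 1), s(0, 2), s(0, 3), s(0, 4), s(1, 2), s(2, 3), s(3, 4)},
    -- the complete graph without the two adjacent edges 0-1 and 0-2
    (SimpleGraph.fromEdgeSet {s(0, 1), s(0, 2)})ᶜ,
    -- the wheel with hub 0 and rim 1-2-3-4-1
    SimpleGraph.fromEdgeSet
      {s(0, 1), s(0, 2), s(0, 3), s(0, 4), s(1, 2), s(2, 3), s(3, 4), s(4, 1)},
    -- the complete graph without the edge 0-1
    (SimpleGraph.fromEdgeSet {s(0, 1)})ᶜ,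
    -- the complete graph
    ⊤]

/-- The minimum defining the sum choice number of a finite graph is attained. -/
theorem exists_isChoosable_sum_eq [Fintype V] (G : SimpleGraph V) :
    ∃ f : V → ℕ, IsChoosable G f ∧ ∑ v, f v = sumChoiceNumber G := by
  refine Nat.sInf_mem (s := {m | ∃ f : V → ℕ, IsChoosable G f ∧ ∑ v, f v = m})
    ⟨_, fun _ => Fintype.card V, fun L hL => ?_, rfl⟩
  obtain ⟨c, hc, hcL⟩ := (Finset.all_card_le_biUnion_card_iff_exists_injective L).1 (by
    intro s
    rcases s.eq_empty_or_nonempty with rfl | ⟨v, hv⟩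
    · simp
    · calc s.card ≤ Fintype.card V := s.card_le_univ
        _ = (L v).card := (hL v).symm
        _ ≤ _ := Finset.card_le_card (Finset.subset_biUnion_of_mem L hv))
  exact ⟨SimpleGraph.Coloring.mk c fun {a b} hab h => hab.ne (hc h), hcL⟩

end SumChoice

/-!
Fix a graph `G`. Coloring a vertex `v` last shows that the sum choice number of `G` is at most that
of `G - v` plus `deg v + 1`, so the greedy bound is an upper bound
(`sumChoiceNumber_le_greedyBound`). Conversely, a choice function `f` with `f v = 1` or
`deg v < f v` has at least that size. Hence, when all graphs `G - v` are sc-greedy, a choice function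
below the greedy bound must satisfy `2 ≤ f v ≤ deg v` at every vertex
(`two_le_and_le_degree_of_sum_lt`). This settles graphs with at most four vertices, all of which are
sc-greedy, and leaves few candidates `f` for a graph on five vertices.

A graph on five vertices that is disconnected or has a cut vertex either has a vertex of degree at
most one, which excludes all candidates, or has two disjoint pairs of vertices without edges in
between. In the latter case only two triangles with a common vertex remain, with `f = 2` everywhere,
and explicit lists rule this out (`isSCGreedy_of_not_isNonseparable`).

A connected graph on five vertices without a cut vertex has a spanning cycle, or two vertices that
form the neighborhood of each of the other three (`IsNonseparable.cases_pathPlus`; it contains a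
path on four vertices, which leaves seven possible further edges). In the former case the chords of
the cycle, up to the dihedral group, give eight of the listed graphs; in the latter case the graph
is `K_{2,3}` or `K_{1,1,3}`. For the ten graphs, explicit lists refute all candidates `f` of smaller
size than claimed (`exists_mem_badLists`). The three choice functions below the greedy bound are
verified by going through all list assignments from four colors, which suffices by
`isChoosable_of_lists_range`. The sum choice number and the greedy bound together distinguish the
ten graphs, except for `K_{1,1,3}` and the broken wheel.
-/

namespace SumChoice

/-! ### Choice functions -/

section Basic

variable {V W : Type*}

theorem IsChoosable.mono {G : SimpleGraph V} {f g : V → ℕ} (h : IsChoosable G f) (hfg : f ≤ g) :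
    IsChoosable G g := by
  intro L hL
  choose L' hL' hc using fun v => Finset.exists_subset_card_eq ((hfg v).trans (hL v).ge)
  obtain ⟨c, hcL⟩ := h L' hc
  exact ⟨c, fun v => hL' v (hcL v)⟩

/-- Lists that admit no proper coloring, and are at least as long as prescribed, refute
choosability. -/
theorem not_isChoosable_of_lists {G : SimpleGraph V} {f : V → ℕ} (L : V → Finset ℕ)
    (hf : ∀ v, f v ≤ (L v).card)
    (hL : ∀ c : V → ℕ, (∀ v, c v ∈ L v) → ∃ u v, G.Adj u v ∧ c u = c v) : ¬ IsChoosable G f := by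
  intro h
  obtain ⟨c, hc⟩ := h.mono (g := fun v => (L v).card) hf L fun _ => rfl
  obtain ⟨u, v, huv, he⟩ := hL c hc
  exact c.valid huv he

theorem IsChoosable.pos {G : SimpleGraph V} {f : V → ℕ} (h : IsChoosable G f) (v : V) :
    0 < f v := by
  obtain ⟨c, hc⟩ := h (fun v => Finset.range (f v)) (by simp)
  exact (Nat.zero_le _).trans_lt (Finset.mem_range.1 (hc v))

theorem IsChoosable.of_iso {G : SimpleGraph V} {H : SimpleGraph W} (e : G ≃g H) {f : W → ℕ}
    (h : IsChoosable H f) : IsChoosable G (fun v => f (e v)) := by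
  intro L hL
  obtain ⟨c, hc⟩ := h (fun w => L (e.symm w)) fun w => by simp [hL]
  exact ⟨c.comp e.toHom, fun v => by simpa using hc (e v)⟩

theorem IsChoosable.induce {G : SimpleGraph V} {f : V → ℕ} (h : IsChoosable G f) (s : Set V) :
    IsChoosable (G.induce s) (fun v => f v) := by
  classical
  intro L hL
  obtain ⟨c, hc⟩ := h (fun v => if hv : v ∈ s then L ⟨v, hv⟩ else Finset.range (f v)) fun v => by
    split_ifs with hv
    · exact hL ⟨v, hv⟩
    · simp
  refine ⟨c.comp (SimpleGraph.Embedding.induce s).toHom, fun v => ?_⟩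
  simpa using hc v

/-- A vertex whose list is longer than its degree can be colored last. -/
theorem IsChoosable.of_induce_compl {G : SimpleGraph V} {v : V} [Fintype (G.neighborSet v)]
    {f : V → ℕ} (h : IsChoosable (G.induce {v}ᶜ) (fun u => f u)) (hv : G.degree v < f v) :
    IsChoosable G f := by
  classical
  intro L hL
  obtain ⟨c, hc⟩ := h (fun u => L u) fun u => hL u
  have hlt : ((G.neighborFinset v).image
      fun u => if hu : u ∈ ({v}ᶜ : Set V) then c ⟨u, hu⟩ else 0).card < (L v).card :=
    Finset.card_image_le.trans_lt (by rw [hL]; exact hv)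
  obtain ⟨a, ha, hna⟩ := Finset.exists_mem_notMem_of_card_lt_card hlt
  have hne : ∀ u (hu : u ∈ ({v}ᶜ : Set V)), G.Adj v u → c ⟨u, hu⟩ ≠ a := by
    rintro u hu huv rfl
    refine hna (Finset.mem_image.2 ⟨u, by simpa using huv, ?_⟩)
    rw [dif_pos hu]
  refine ⟨SimpleGraph.Coloring.mk
    (fun u => if hu : u ∈ ({v}ᶜ : Set V) then c ⟨u, hu⟩ else a) ?_, ?_⟩
  · intro x y hxy
    by_cases hx : x = v
    · subst hx
      have hy : y ∈ ({x}ᶜ : Set V) := hxy.ne'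
      have := hne y hy hxy
      simpa [hxy.ne'] using this.symm
    · by_cases hy : y = v
      · subst hy
        have := hne x hx hxy.symm
        simpa [hx] using this
      · have hx' : x ∈ ({v}ᶜ : Set V) := hx
        have hy' : y ∈ ({v}ᶜ : Set V) := hy
        rw [dif_pos hx', dif_pos hy']
        exact c.valid (show (G.induce {v}ᶜ).Adj ⟨x, hx'⟩ ⟨y, hy'⟩ from hxy)
  · intro u
    by_cases hu : u = v
    · subst hu
      change (if hu : u ∈ ({u}ᶜ : Set V) then c ⟨u, hu⟩ else a) ∈ L u
      simpa using ha
    · have hu' : u ∈ ({v}ᶜ : Set V) := hu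
      change (if hu : u ∈ ({v}ᶜ : Set V) then c ⟨u, hu⟩ else a) ∈ L u
      rw [dif_pos hu']
      exact hc ⟨u, hu'⟩

/-- A vertex with a single color forbids that color to its neighbors, all of whose lists may contain
it. So the rest of the graph can be colored from lists that are shorter by one at the neighbors. -/
theorem IsChoosable.induce_compl_of_eq_one [Finite V] {G : SimpleGraph V} [DecidableRel G.Adj]
    {v : V} {f : V → ℕ} (h : IsChoosable G f) (hv : f v = 1) :
    IsChoosable (G.induce {v}ᶜ) (fun u => f u - if G.Adj v u then 1 else 0) := by
  classical
  intro L hL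
  have := Fintype.ofFinite V
  -- a color that is in none of the given lists
  obtain ⟨a, ha⟩ := Infinite.exists_notMem_finset (Finset.univ.biUnion L)
  have ha' : ∀ u, a ∉ L u := fun u hu => ha (Finset.mem_biUnion.2 ⟨u, Finset.mem_univ _, hu⟩)
  obtain ⟨c, hc⟩ := h (fun u => if hu : u ∈ ({v}ᶜ : Set V) then
      if G.Adj v u then insert a (L ⟨u, hu⟩) else L ⟨u, hu⟩ else {a}) fun u => by
    by_cases hu : u = v
    · subst hu
      simp [hv]
    · have hu' : u ∈ ({v}ᶜ : Set V) := hu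
      have h1 : (L ⟨u, hu'⟩).card = f u - if G.Adj v u then 1 else 0 := hL ⟨u, hu'⟩
      have h2 := h.pos u
      rw [dif_pos hu']
      split_ifs with huv
      · rw [Finset.card_insert_of_notMem (ha' _), h1, if_pos huv]
        omega
      · rw [h1, if_neg huv, Nat.sub_zero]
  have hcv : c v = a := by simpa using hc v
  refine ⟨c.comp (SimpleGraph.Embedding.induce _).toHom, fun u => ?_⟩
  have hu : (u : V) ∈ ({v}ᶜ : Set V) := u.2
  have h1 := hc u
  rw [dif_pos hu] at h1
  change c u ∈ L u
  split_ifs at h1 with huv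
  · refine Finset.mem_of_mem_insert_of_ne h1 ?_
    rw [← hcv]
    exact (c.valid huv).symm
  · exact h1

/-! ### The sum choice number and the greedy bound -/

variable [Fintype V] [Fintype W]

theorem IsChoosable.sumChoiceNumber_le {G : SimpleGraph V} {f : V → ℕ} (h : IsChoosable G f) :
    sumChoiceNumber G ≤ ∑ v, f v :=
  Nat.sInf_le ⟨f, h, rfl⟩

theorem le_sumChoiceNumber {G : SimpleGraph V} {n : ℕ}
    (h : ∀ f : V → ℕ, IsChoosable G f → n ≤ ∑ v, f v) : n ≤ sumChoiceNumber G := by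
  obtain ⟨f, hf, hs⟩ := exists_isChoosable_sum_eq G
  exact hs ▸ h f hf

theorem sumChoiceNumber_le_of_iso {G : SimpleGraph V} {H : SimpleGraph W} (e : G ≃g H) :
    sumChoiceNumber G ≤ sumChoiceNumber H := by
  obtain ⟨f, hf, hs⟩ := exists_isChoosable_sum_eq H
  rw [← hs, ← Equiv.sum_comp e.toEquiv f]
  exact (hf.of_iso e).sumChoiceNumber_le

theorem sumChoiceNumber_congr {G : SimpleGraph V} {H : SimpleGraph W} (e : G ≃g H) :
    sumChoiceNumber G = sumChoiceNumber H :=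
  (sumChoiceNumber_le_of_iso e).antisymm (sumChoiceNumber_le_of_iso e.symm)

theorem greedyBound_congr {G : SimpleGraph V} {H : SimpleGraph W} (e : G ≃g H) :
    greedyBound G = greedyBound H := by
  rw [greedyBound, greedyBound, Fintype.card_congr e.toEquiv, ← Nat.card_coe_set_eq,
    ← Nat.card_coe_set_eq, Nat.card_congr e.mapEdgeSet]

theorem isSCGreedy_congr {G : SimpleGraph V} {H : SimpleGraph W} (e : G ≃g H) :
    IsSCGreedy G ↔ IsSCGreedy H := by
  rw [IsSCGreedy, IsSCGreedy, sumChoiceNumber_congr e, greedyBound_congr e]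

theorem greedyBound_eq_card_edgeFinset (G : SimpleGraph V) [Fintype G.edgeSet] :
    greedyBound G = Fintype.card V + G.edgeFinset.card := by
  rw [greedyBound, Set.ncard_eq_toFinset_card', SimpleGraph.edgeFinset]

section Delete

variable [DecidableEq V] (G : SimpleGraph V) [DecidableRel G.Adj] (v : V)

theorem greedyBound_induce_compl :
    greedyBound (G.induce {v}ᶜ) + (G.degree v + 1) = greedyBound G := by
  rw [greedyBound_eq_card_edgeFinset, greedyBound_eq_card_edgeFinset,
    G.card_edgeFinset_induce_compl_singleton v, SimpleGraph.card_edgeFinset_deleteIncidenceSet]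
  have h1 : Fintype.card (({v}ᶜ : Set V)) = Fintype.card V - 1 := by
    rw [Fintype.card_compl_set]; simp
  have h2 : 0 < Fintype.card V := Fintype.card_pos_iff.2 ⟨v⟩
  have h3 : G.degree v ≤ G.edgeFinset.card := by
    rw [← G.card_incidenceFinset_eq_degree v]
    exact Finset.card_le_card (G.incidenceFinset_subset v)
  omega

theorem sum_eq_add_sum_compl (f : V → ℕ) :
    ∑ u, f u = f v + ∑ u : ({v}ᶜ : Set V), f u := by
  rw [← Finset.add_sum_erase _ _ (Finset.mem_univ v)]
  congr 1
  rw [← Finset.sum_coe_sort]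
  exact Fintype.sum_equiv (Equiv.subtypeEquivRight (by simp)) _ _ fun _ => rfl

theorem sumChoiceNumber_le_induce_compl :
    sumChoiceNumber G ≤ sumChoiceNumber (G.induce {v}ᶜ) + (G.degree v + 1) := by
  obtain ⟨f, hf, hs⟩ := exists_isChoosable_sum_eq (G.induce {v}ᶜ)
  have key : IsChoosable G
      (fun u => if hu : u ∈ ({v}ᶜ : Set V) then f ⟨u, hu⟩ else G.degree v + 1) := by
    refine IsChoosable.of_induce_compl (v := v) ?_ (by simp)
    convert hf using 2 with u
    rw [dif_pos u.2]
  refine key.sumChoiceNumber_le.trans_eq ?_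
  rw [sum_eq_add_sum_compl v, add_comm, ← hs]
  simp

/-- A choice function that is `1` at `v`, or exceeds the degree of `v`, is at least as large as the
best choice function for `G - v` extended greedily to `v`. -/
theorem sumChoiceNumber_induce_compl_add_le {f : V → ℕ} (hf : IsChoosable G f)
    (hv : f v ≤ 1 ∨ G.degree v < f v) :
    sumChoiceNumber (G.induce {v}ᶜ) + (G.degree v + 1) ≤ ∑ u, f u := by
  rw [sum_eq_add_sum_compl v]
  by_cases h : G.degree v < f v
  · have := (hf.induce {v}ᶜ).sumChoiceNumber_le
    omega
  · have h1 : f v = 1 := by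
      have := hf.pos v
      omega
    have := (hf.induce_compl_of_eq_one h1).sumChoiceNumber_le
    have h2 : ∑ u : ({v}ᶜ : Set V), (f u - if G.Adj v u then 1 else 0) + G.degree v
        = ∑ u : ({v}ᶜ : Set V), f u := by
      have h3 := sum_eq_add_sum_compl v (fun u => if G.Adj v u then 1 else 0)
      rw [Finset.sum_boole, if_neg (G.irrefl), zero_add, ← G.neighborFinset_eq_filter] at h3
      rw [← G.card_neighborFinset_eq_degree]
      rw [Nat.cast_id] at h3
      rw [h3, ← Finset.sum_add_distrib]
      refine Finset.sum_congr rfl fun u _ => ?_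
      have := hf.pos u
      split_ifs <;> omega
    omega

end Delete

theorem sumChoiceNumber_le_greedyBound (G : SimpleGraph V) :
    sumChoiceNumber G ≤ greedyBound G := by
  classical
  induction h : Fintype.card V generalizing V with
  | zero =>
    have := Fintype.card_eq_zero_iff.1 h
    refine (IsChoosable.sumChoiceNumber_le (f := 0) fun L _ => ?_).trans (by simp)
    exact ⟨SimpleGraph.Coloring.mk isEmptyElim (fun {a} => isEmptyElim a), isEmptyElim⟩
  | succ n ih =>
    obtain ⟨v⟩ : Nonempty V := Fintype.card_pos_iff.1 (by omega)
    have := ih (G.induce {v}ᶜ) (by rw [Fintype.card_compl_set]; simp [h])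
    have := sumChoiceNumber_le_induce_compl G v
    have := greedyBound_induce_compl G v
    omega

theorem isSCGreedy_iff {G : SimpleGraph V} :
    IsSCGreedy G ↔ ∀ f : V → ℕ, IsChoosable G f → greedyBound G ≤ ∑ v, f v :=
  ⟨fun h _ hf => h ▸ hf.sumChoiceNumber_le,
    fun h => (sumChoiceNumber_le_greedyBound G).antisymm (le_sumChoiceNumber h)⟩

/-- When all vertex-deleted subgraphs are sc-greedy, a choice function that beats the greedy bound
lies between `2` and the degree at every vertex. -/
theorem two_le_and_le_degree_of_sum_lt {G : SimpleGraph V} [DecidableEq V] [DecidableRel G.Adj]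
    (hG : ∀ v, IsSCGreedy (G.induce {v}ᶜ)) {f : V → ℕ} (hf : IsChoosable G f)
    (hlt : ∑ v, f v < greedyBound G) (v : V) : 2 ≤ f v ∧ f v ≤ G.degree v := by
  by_contra hcon
  have h1 := sumChoiceNumber_induce_compl_add_le G v hf (by omega)
  have h2 : sumChoiceNumber (G.induce {v}ᶜ) = _ := hG v
  have h3 := greedyBound_induce_compl G v
  omega

end Basic

/-! ### Graphs on at most four vertices -/

section Small

variable {V : Type*}

theorem IsChoosable.colorable {G : SimpleGraph V} {f : V → ℕ} {k : ℕ} (h : IsChoosable G f)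
    (hk : ∀ v, f v ≤ k) : G.Colorable k := by
  obtain ⟨c, hc⟩ := h (fun v => Finset.range (f v)) (by simp)
  exact ⟨SimpleGraph.Coloring.mk (fun v => ⟨c v, (Finset.mem_range.1 (hc v)).trans_le (hk v)⟩)
    fun huv he => c.valid huv (congrArg Fin.val he)⟩

/-- On four vertices, a choice function `f` below the greedy bound, used with the lists
`{0, …, f v - 1}`, would color `K₄` with three colors or a graph with five edges with two. -/
theorem isSCGreedy_of_card_le_four [Fintype V] (G : SimpleGraph V) (hV : Fintype.card V ≤ 4) :
    IsSCGreedy G := by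
  classical
  induction h : Fintype.card V generalizing V with
  | zero =>
    have := Fintype.card_eq_zero_iff.1 h
    rw [isSCGreedy_iff]
    intro f _
    simp [greedyBound, Subsingleton.elim G ⊥]
  | succ n ih =>
    have hdel : ∀ v, IsSCGreedy (G.induce {v}ᶜ) := fun v => by
      have hc : Fintype.card ({v}ᶜ : Set V) = n := by rw [Fintype.card_compl_set]; simp [h]
      exact ih _ (by omega) hc
    rw [isSCGreedy_iff]
    intro f hf
    by_contra! hlt
    have hfd := two_le_and_le_degree_of_sum_lt hdel hf hlt
    have hE := G.sum_degrees_eq_twice_card_edges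
    have hGB := greedyBound_eq_card_edgeFinset G
    have hdeg : ∀ v, G.degree v ≤ n := fun v => by
      have := G.degree_lt_card_verts v
      omega
    have h1 : ∑ v, G.degree v ≤ (n + 1) * n := by
      simpa [h] using Finset.sum_le_sum fun v (_ : v ∈ Finset.univ) => hdeg v
    have h2 : (n + 1) * 2 ≤ ∑ v, f v := by
      simpa [h] using Finset.sum_le_sum fun v (_ : v ∈ Finset.univ) => (hfd v).1
    obtain rfl | hn : n = 3 ∨ n ≤ 2 := by omega
    · have h3 : ∀ v, f v + 6 ≤ ∑ u, f u := fun v => by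
        have h4 := Finset.card_nsmul_le_sum (Finset.univ.erase v) f 2 fun u _ => (hfd u).1
        rw [Finset.card_erase_of_mem (Finset.mem_univ v), Finset.card_univ, h] at h4
        have h5 := Finset.add_sum_erase _ f (Finset.mem_univ v)
        have h6 : 6 ≤ ∑ u ∈ Finset.univ.erase v, f u := h4
        omega
      obtain he | he : G.edgeFinset.card = 6 ∨ G.edgeFinset.card = 5 := by omega
      · -- the complete graph would be colored with three colors
        have hd : ∀ v, G.degree v = 3 := by
          by_contra! hcon
          obtain ⟨v, hv⟩ := hcon
          have : ∑ v, G.degree v < ∑ v : V, 3 :=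
            Finset.sum_lt_sum (fun u _ => hdeg u) ⟨v, Finset.mem_univ v, (hdeg v).lt_of_ne hv⟩
          simp [h] at this
          omega
        obtain ⟨c⟩ := hf.colorable (k := 3) fun v => by have := h3 v; omega
        obtain ⟨u, v, huv, hc⟩ := Fintype.exists_ne_map_eq_of_card_lt c (by simp [h])
        have hu := (G.degree_eq_card_sub_one u).1 (by rw [hd, h])
        exact c.valid (hu huv) hc
      · -- a bipartite graph on four vertices has at most four edges
        have hb : G.IsBipartite := hf.colorable fun v => by have := h3 v; omega
        have h4 := hb.four_mul_encard_edgeSet_le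
        rw [← SimpleGraph.coe_edgeFinset, Set.encard_coe_eq_coe_finsetCard, he,
          ENat.card_eq_coe_fintype_card, h] at h4
        norm_num at h4
    · interval_cases n <;> omega

end Small

/-! ### Few colors suffice -/

section Colors

variable {V : Type*} [Fintype V]

/-- To refute choosability it is enough to consider lists with fewer colors than vertices in total.
Indeed, let `X` be a largest set of vertices whose lists contain fewer than `|X|` colors. By Hall's
theorem, the vertices outside `X` can be colored by distinct colors that are in no list of `X`.
So only the lists on `X` matter. -/
theorem isChoosable_of_lists_range {G : SimpleGraph V} {f : V → ℕ} {n : ℕ}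
    (hV : Fintype.card V = n + 1) (hf : ∀ v, f v ≤ n)
    (h : ∀ L : V → Finset ℕ, (∀ v, L v ∈ (Finset.range n).powersetCard (f v)) →
      ∃ c : G.Coloring ℕ, ∀ v, c v ∈ L v) : IsChoosable G f := by
  classical
  intro L hL
  obtain ⟨X, hX, hmax⟩ := Finset.exists_max_image
    ({X : Finset V | (X.biUnion L).card < X.card ∨ X = ∅} : Finset (Finset V)) Finset.card
    ⟨∅, by simp⟩
  simp only [Finset.mem_filter, Finset.mem_univ, true_and] at hX hmax
  set C := X.biUnion L with hC
  have hCX : C.card ≤ X.card := by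
    rcases hX with hX | rfl
    · exact hX.le
    · simp [hC]
  have hCn : C.card ≤ n := by
    rcases hX with hX | rfl
    · have := X.card_le_univ
      omega
    · simp [hC]
  obtain ⟨g, hg, hgL⟩ := (Finset.all_card_le_biUnion_card_iff_exists_injective
    (fun v : {v // v ∉ X} => L v \ C)).1 (by
      intro s
      rcases s.eq_empty_or_nonempty with rfl | ⟨v, hv⟩
      · simp
      · set Y := s.map (Function.Embedding.subtype _) with hY
        have hdisj : Disjoint X Y := by
          rw [Finset.disjoint_left]
          intro x hx hxY
          obtain ⟨y, -, rfl⟩ := Finset.mem_map.1 hxY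
          exact y.2 hx
        have hYs : Y.card = s.card := Finset.card_map _
        have hs : 0 < s.card := Finset.card_pos.2 ⟨v, hv⟩
        have hXY : (X ∪ Y).card = X.card + Y.card := Finset.card_union_of_disjoint hdisj
        have h1 : ¬ ((X ∪ Y).biUnion L).card < (X ∪ Y).card := fun hlt => by
          have := hmax _ (Or.inl hlt)
          omega
        have h2 : (X ∪ Y).biUnion L ⊆ C ∪ s.biUnion fun v => L v \ C := by
          intro a ha
          simp only [Finset.mem_biUnion, Finset.mem_union, Finset.mem_sdiff] at ha ⊢
          by_cases haC : a ∈ C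
          · exact Or.inl haC
          · obtain ⟨x, hx | hx, hax⟩ := ha
            · exact absurd (Finset.mem_biUnion.2 ⟨x, hx, hax⟩) haC
            · obtain ⟨y, hy, rfl⟩ := Finset.mem_map.1 hx
              exact Or.inr ⟨y, hy, hax, haC⟩
        have h3 := (Finset.card_le_card h2).trans (Finset.card_union_le _ _)
        omega)
  have hinj : ∀ x ∈ C, Nat.nth (· ∈ C) (Nat.count (· ∈ C) x) = x := fun x hx => Nat.nth_count hx
  have hXC : ∀ v ∈ X, L v ⊆ C := fun v hv => Finset.subset_biUnion_of_mem L hv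
  -- the colors of `C` are renamed to `0, 1, …`; outside `X` the lists are irrelevant
  obtain ⟨c, hc⟩ := h
    (fun v => if v ∈ X then (L v).image (Nat.count (· ∈ C)) else Finset.range (f v)) fun v => by
    rw [Finset.mem_powersetCard]
    split_ifs with hv
    · constructor
      · intro a ha
        obtain ⟨b, hb, rfl⟩ := Finset.mem_image.1 ha
        have hfin : {x | x ∈ C}.Finite := C.finite_toSet
        refine Finset.mem_range.2 ((Nat.count_lt_card hfin (hXC v hv hb)).trans_le ?_)
        have : hfin.toFinset = C := by ext; simp
        rwa [this]
      · rw [Finset.card_image_of_injOn, hL]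
        intro a ha b hb hab
        rw [← hinj a (hXC v hv ha), ← hinj b (hXC v hv hb)]
        exact congrArg _ hab
    · simp [hf v]
  have hcX : ∀ v ∈ X, Nat.nth (· ∈ C) (c v) ∈ L v ∧
      Nat.count (· ∈ C) (Nat.nth (· ∈ C) (c v)) = c v := fun v hv => by
    have h1 := hc v
    rw [if_pos hv] at h1
    obtain ⟨a, ha, hac⟩ := Finset.mem_image.1 h1
    rw [← hac, hinj a (hXC v hv ha)]
    exact ⟨ha, rfl⟩
  have hgC : ∀ v (hv : v ∉ X), g ⟨v, hv⟩ ∈ L v ∧ g ⟨v, hv⟩ ∉ C := fun v hv =>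
    Finset.mem_sdiff.1 (hgL ⟨v, hv⟩)
  refine ⟨SimpleGraph.Coloring.mk
    (fun v => if hv : v ∈ X then Nat.nth (· ∈ C) (c v) else g ⟨v, hv⟩) ?_, fun v => ?_⟩
  · intro u v huv he
    by_cases hu : u ∈ X <;> by_cases hv : v ∈ X
    · rw [dif_pos hu, dif_pos hv] at he
      refine c.valid huv ?_
      rw [← (hcX u hu).2, ← (hcX v hv).2, he]
    · rw [dif_pos hu, dif_neg hv] at he
      exact (hgC v hv).2 (he ▸ hXC u hu (hcX u hu).1)
    · rw [dif_neg hu, dif_pos hv] at he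
      exact (hgC u hu).2 (he ▸ hXC v hv (hcX v hv).1)
    · rw [dif_neg hu, dif_neg hv] at he
      exact huv.ne (congrArg Subtype.val (hg he))
  · change (if hv : v ∈ X then Nat.nth (· ∈ C) (c v) else g ⟨v, hv⟩) ∈ L v
    split_ifs with hv
    · exact (hcX v hv).1
    · exact (hgC v hv).1

end Colors

/-! ### List colorings of graphs on five vertices by computation -/

/-- Whether the graph on `Fin 5` with adjacency matrix `A` can be properly colored from the lists
`l₀, …, l₄`. Only the entries of `A` above the diagonal are read. -/
def listColorable (A : Fin 5 → Fin 5 → Bool) (l₀ l₁ l₂ l₃ l₄ : List ℕ) : Bool :=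
  l₀.any fun c₀ => l₁.any fun c₁ => !(c₀.beq c₁ && A 0 1) &&
  l₂.any fun c₂ => !(c₀.beq c₂ && A 0 2) && !(c₁.beq c₂ && A 1 2) &&
  l₃.any fun c₃ => !(c₀.beq c₃ && A 0 3) && !(c₁.beq c₃ && A 1 3) && !(c₂.beq c₃ && A 2 3) &&
  l₄.any fun c₄ => !(c₀.beq c₄ && A 0 4) && !(c₁.beq c₄ && A 1 4) && !(c₂.beq c₄ && A 2 4) &&
    !(c₃.beq c₄ && A 3 4)

theorem listColorable_iff {A : Fin 5 → Fin 5 → Bool} {L : Fin 5 → List ℕ} :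
    listColorable A (L 0) (L 1) (L 2) (L 3) (L 4) = true ↔
      ∃ c : Fin 5 → ℕ, (∀ v, c v ∈ L v) ∧ ∀ u v, u < v → A u v = true → c u ≠ c v := by
  simp only [listColorable, List.any_eq_true, Bool.and_eq_true, Bool.not_eq_true',
    Nat.beq_eq, Bool.eq_false_iff, ne_eq]
  constructor
  · rintro ⟨c₀, h0, c₁, h1, a01, c₂, h2, ⟨a02, a12⟩, c₃, h3, ⟨⟨a03, a13⟩, a23⟩, c₄, h4,
      ⟨⟨a04, a14⟩, a24⟩, a34⟩
    refine ⟨![c₀, c₁, c₂, c₃, c₄], ?_, ?_⟩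
    · simp [Fin.forall_fin_succ, *]
    · intro u v huv hA he
      fin_cases u <;> fin_cases v <;> first | exact absurd huv (by decide) | simp_all
  · rintro ⟨c, hc, h⟩
    have key : ∀ u v, u < v → ¬ (c u = c v ∧ A u v = true) :=
      fun u v huv ⟨he, hA⟩ => h u v huv hA he
    exact ⟨c 0, hc 0, c 1, hc 1, key _ _ (by decide), c 2, hc 2,
      ⟨key _ _ (by decide), key _ _ (by decide)⟩, c 3, hc 3,
      ⟨⟨key _ _ (by decide), key _ _ (by decide)⟩, key _ _ (by decide)⟩, c 4, hc 4,
      ⟨⟨key _ _ (by decide), key _ _ (by decide)⟩, key _ _ (by decide)⟩, key _ _ (by decide)⟩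

/-- The matrix `A` may miss edges of `G`. -/
theorem not_isChoosable_of_listColorable_eq_false {G : SimpleGraph (Fin 5)}
    {A : Fin 5 → Fin 5 → Bool} (hA : ∀ u v, A u v = true → G.Adj u v) {f : Fin 5 → ℕ}
    (L : Fin 5 → List ℕ) (hf : ∀ v, f v ≤ (L v).toFinset.card)
    (hL : listColorable A (L 0) (L 1) (L 2) (L 3) (L 4) = false) : ¬ IsChoosable G f := by
  refine not_isChoosable_of_lists (fun v => (L v).toFinset) hf fun c hc => ?_
  by_contra! hcon
  have : listColorable A (L 0) (L 1) (L 2) (L 3) (L 4) = true :=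
    listColorable_iff.2 ⟨c, fun v => List.mem_toFinset.1 (hc v), fun u v _ h => hcon u v (hA u v h)⟩
  simp [hL] at this

/-- The lists of two or three of the four colors `0, 1, 2, 3`. -/
def listsOfFour : ℕ → List (List ℕ)
  | 2 => [[0, 1], [0, 2], [0, 3], [1, 2], [1, 3], [2, 3]]
  | 3 => [[0, 1, 2], [0, 1, 3], [0, 2, 3], [1, 2, 3]]
  | _ => []

theorem filter_mem_listsOfFour {s : Finset ℕ} {k : ℕ} (hk : k = 2 ∨ k = 3)
    (hs : s ∈ (Finset.range 4).powersetCard k) :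
    (List.range 4).filter (· ∈ s) ∈ listsOfFour k := by
  obtain rfl | rfl := hk <;> revert s <;> decide

/-- Choosability with lists of two or three colors on five vertices is a finite problem, since four
colors suffice. -/
theorem isChoosable_of_listColorable {G : SimpleGraph (Fin 5)} {A : Fin 5 → Fin 5 → Bool}
    (hA : ∀ u v, G.Adj u v → A u v = true) {f : Fin 5 → ℕ} (hf : ∀ v, f v = 2 ∨ f v = 3)
    (h : ∀ l₀ ∈ listsOfFour (f 0), ∀ l₁ ∈ listsOfFour (f 1), ∀ l₂ ∈ listsOfFour (f 2),
      ∀ l₃ ∈ listsOfFour (f 3), ∀ l₄ ∈ listsOfFour (f 4),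
      listColorable A l₀ l₁ l₂ l₃ l₄ = true) : IsChoosable G f := by
  refine isChoosable_of_lists_range (n := 4) rfl (fun v => by have := hf v; omega) fun L hL => ?_
  have hmem : ∀ v, (List.range 4).filter (· ∈ L v) ∈ listsOfFour (f v) := fun v =>
    filter_mem_listsOfFour (hf v) (hL v)
  obtain ⟨c, hc, hA'⟩ := (listColorable_iff (L := fun v => (List.range 4).filter (· ∈ L v))).1
    (h _ (hmem 0) _ (hmem 1) _ (hmem 2) _ (hmem 3) _ (hmem 4))
  refine ⟨SimpleGraph.Coloring.mk c fun {u v} huv => ?_, fun v => ?_⟩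
  · rcases huv.ne.lt_or_gt with hlt | hlt
    · exact hA' u v hlt (hA u v huv)
    · exact (hA' v u hlt (hA v u huv.symm)).symm
  · exact of_decide_eq_true (List.mem_filter.1 (hc v)).2

/-! ### The ten graphs -/

/-- The edges of `graphFive i`, each listed with its smaller endpoint first. -/
def edgesFive : Fin 10 → List (Fin 5 × Fin 5) :=
  ![[(0, 1), (1, 2), (2, 3), (3, 4), (0, 4)],
    [(0, 2), (0, 3), (0, 4), (1, 2), (1, 3), (1, 4)],
    [(0, 1), (0, 2), (1, 2), (0, 3), (3, 4), (1, 4)],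
    [(0, 1), (0, 4), (1, 2), (1, 3), (2, 4), (3, 4), (2, 3)],
    [(0, 2), (0, 3), (0, 4), (1, 2), (1, 3), (1, 4), (0, 1)],
    [(0, 1), (0, 2), (0, 3), (0, 4), (1, 2), (2, 3), (3, 4)],
    [(0, 3), (0, 4), (1, 2), (1, 3), (1, 4), (2, 3), (2, 4), (3, 4)],
    [(0, 1), (0, 2), (0, 3), (0, 4), (1, 2), (2, 3), (3, 4), (1, 4)],
    [(0, 2), (0, 3), (0, 4), (1, 2), (1, 3), (1, 4), (2, 3), (2, 4), (3, 4)],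
    [(0, 1), (0, 2), (0, 3), (0, 4), (1, 2), (1, 3), (1, 4), (2, 3), (2, 4), (3, 4)]]

/-- The adjacency matrix of `graphFive i`. -/
def adjFive (i : Fin 10) (u v : Fin 5) : Bool :=
  (edgesFive i).any fun p => p == (u, v) || p == (v, u)

theorem graphFive_adj (i : Fin 10) (u v : Fin 5) :
    (graphFive i).Adj u v ↔ adjFive i u v = true := by
  fin_cases i <;> simp [graphFive] <;> revert u v <;> decide

instance (i : Fin 10) : DecidableRel (graphFive i).Adj :=
  fun u v => decidable_of_iff _ (graphFive_adj i u v).symm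

/-! ### Sum choice numbers of the ten graphs -/

theorem greedyBound_graphFive (i : Fin 10) :
    greedyBound (graphFive i)
      = (![10, 11, 11, 12, 12, 12, 13, 13, 14, 15] : Fin 10 → ℕ) i := by
  rw [greedyBound_eq_card_edgeFinset]
  revert i
  decide +kernel

theorem isChoosable_graphFive_one : IsChoosable (graphFive 1) ![2, 2, 2, 2, 2] :=
  isChoosable_of_listColorable (fun u v => (graphFive_adj 1 u v).1) (by decide) (by decide +kernel)

theorem isChoosable_graphFive_three : IsChoosable (graphFive 3) ![2, 2, 3, 2, 2] :=
  isChoosable_of_listColorable (fun u v => (graphFive_adj 3 u v).1) (by decide) (by decide +kernel)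

theorem isChoosable_graphFive_seven : IsChoosable (graphFive 7) ![3, 3, 2, 2, 2] :=
  isChoosable_of_listColorable (fun u v => (graphFive_adj 7 u v).1) (by decide) (by decide +kernel)

/-- Candidates for list assignments of sizes `f` without a proper coloring. In all but one of the
cases below, cyclic intervals of the four colors suffice, which mostly start at color `0`. In
`K_{1,1,3}` with a longer list at one hub, the lists of the leaves exclude all pairs of colors for
the hubs. -/
def badLists (f : Fin 5 → ℕ) : List (Fin 5 → List ℕ) :=
  [![0, 0, 0, 0, 0], ![0, 0, 0, 1, 1], ![0, 2, 0, 0, 0]].map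
      (fun (s : Fin 5 → ℕ) v => (List.range (f v)).map fun k => (s v + k) % 4) ++
    [![[0, 1, 2], [0, 1], [0, 1], [0, 2], [1, 2]], ![[0, 1], [0, 1, 2], [0, 1], [0, 2], [1, 2]]]

/-- No candidate for a choice function of `graphFive i` with values between `2` and the degrees is
smaller than claimed. -/
theorem exists_mem_badLists : ∀ i : Fin 10,
    ∀ a ∈ [2, 3, 4], a ≤ (graphFive i).degree 0 → ∀ b ∈ [2, 3, 4], b ≤ (graphFive i).degree 1 →
    ∀ c ∈ [2, 3, 4], c ≤ (graphFive i).degree 2 → ∀ d ∈ [2, 3, 4], d ≤ (graphFive i).degree 3 →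
    ∀ e ∈ [2, 3, 4], e ≤ (graphFive i).degree 4 →
    a + b + c + d + e < (![10, 10, 11, 11, 12, 12, 13, 12, 14, 15] : Fin 10 → ℕ) i →
    ∃ L ∈ badLists ![a, b, c, d, e], (∀ v, ![a, b, c, d, e] v ≤ (L v).toFinset.card) ∧
      listColorable (adjFive i) (L 0) (L 1) (L 2) (L 3) (L 4) = false := by
  decide +kernel

theorem le_sum_of_isChoosable_graphFive {i : Fin 10} {f : Fin 5 → ℕ}
    (hf : IsChoosable (graphFive i) f) :
    (![10, 10, 11, 11, 12, 12, 13, 12, 14, 15] : Fin 10 → ℕ) i ≤ ∑ v, f v := by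
  by_contra! hlt
  have hle : (![10, 10, 11, 11, 12, 12, 13, 12, 14, 15] : Fin 10 → ℕ) i
      ≤ greedyBound (graphFive i) := by
    rw [greedyBound_graphFive]
    clear hlt hf
    revert i
    decide
  have hfd := two_le_and_le_degree_of_sum_lt
    (fun v => isSCGreedy_of_card_le_four _ (by rw [Fintype.card_compl_set]; simp)) hf
    (hlt.trans_le hle)
  have hmem : ∀ v, f v ∈ [2, 3, 4] := fun v => by
    have h1 := hfd v
    have h2 := (graphFive i).degree_lt_card_verts v
    rw [Fintype.card_fin] at h2
    simp only [List.mem_cons, List.not_mem_nil, or_false]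
    omega
  rw [Fin.sum_univ_five] at hlt
  obtain ⟨L, -, hL, hbad⟩ := exists_mem_badLists i _ (hmem 0) (hfd 0).2 _ (hmem 1) (hfd 1).2
    _ (hmem 2) (hfd 2).2 _ (hmem 3) (hfd 3).2 _ (hmem 4) (hfd 4).2 hlt
  refine not_isChoosable_of_listColorable_eq_false (fun u v => (graphFive_adj i u v).2) L
    (fun v => ?_) hbad hf
  have := hL v
  fin_cases v <;> exact this

theorem sumChoiceNumber_graphFive (i : Fin 10) :
    sumChoiceNumber (graphFive i)
      = (![10, 10, 11, 11, 12, 12, 13, 12, 14, 15] : Fin 10 → ℕ) i := by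
  refine le_antisymm ?_ (le_sumChoiceNumber fun f hf => le_sum_of_isChoosable_graphFive hf)
  by_cases h : i = 1 ∨ i = 3 ∨ i = 7
  · rcases h with rfl | rfl | rfl
    · exact isChoosable_graphFive_one.sumChoiceNumber_le
    · exact isChoosable_graphFive_three.sumChoiceNumber_le
    · exact isChoosable_graphFive_seven.sumChoiceNumber_le
  · refine (sumChoiceNumber_le_greedyBound _).trans ?_
    rw [greedyBound_graphFive]
    revert i
    decide

/-! ### Five vertices, no cut vertex: a spanning cycle or two hubs -/

/-- A reformulation, for graphs on five vertices, of being connected without a cut vertex: no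
neighborhood has at most one element, and there is an edge between any two disjoint pairs of
vertices. -/
def IsNonseparable (G : SimpleGraph (Fin 5)) : Prop :=
  (∀ u v, ∃ w, w ≠ v ∧ G.Adj u w) ∧
    ∀ a b, a ≠ b → ∀ c, c ≠ a → c ≠ b → ¬ G.Adj a c → ¬ G.Adj b c →
      ∀ d, d ≠ a → d ≠ b → d ≠ c → G.Adj a d ∨ G.Adj b d

/-- If `v` is not a cut vertex, then an edge of `G - v` leaves every nontrivial set of vertices. -/
theorem exists_adj_of_not_isCutVertex {V : Type*} {G : SimpleGraph V} (hG : G.Connected) {v : V}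
    (hv : ¬ IsCutVertex G v) {S : Set V} {u w : V} (hu : u ∈ S) (hw : w ∉ S) (huv : u ≠ v)
    (hwv : w ≠ v) : ∃ x y, x ∈ S ∧ y ∉ S ∧ y ≠ v ∧ G.Adj x y := by
  have h : (G.induce {x | x ≠ v}).Reachable ⟨u, huv⟩ ⟨w, hwv⟩ := by
    by_contra hcon
    exact hv ⟨u, w, huv, hwv, hG.preconnected u w, hcon⟩
  obtain ⟨p⟩ := h
  obtain ⟨d, -, h1, h2⟩ := p.exists_boundary_dart {x | (x : V) ∈ S} hu hw
  exact ⟨d.fst, d.snd, h1, h2, d.snd.2, d.adj⟩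

theorem isNonseparable_of_connected {G : SimpleGraph (Fin 5)} (hG : G.Connected)
    (hcut : ∀ v, ¬ IsCutVertex G v) : IsNonseparable G := by
  constructor
  · intro u v
    -- in the absence of such a neighbor, deleting `v'` would isolate `u`
    obtain ⟨v', hv'u, hv'⟩ : ∃ v', v' ≠ u ∧ (v = u ∨ v = v') := by
      by_cases h : v = u
      · obtain ⟨v', hv'⟩ := exists_ne u
        exact ⟨v', hv', Or.inl h⟩
      · exact ⟨v, h, Or.inr rfl⟩
    obtain ⟨w, hwu, hwv⟩ : ∃ w, w ≠ u ∧ w ≠ v' := by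
      clear hv' hv'u
      revert u v'
      decide
    obtain ⟨x, y, rfl, hy, hyv, hxy⟩ := exists_adj_of_not_isCutVertex hG (hcut v')
      (Set.mem_singleton u) hwu hv'u.symm hwv
    refine ⟨y, ?_, hxy⟩
    rintro rfl
    rcases hv' with h | h
    · exact hy h
    · exact hyv h
  · intro a b hab c hca hcb hac hbc d hda hdb hdc
    obtain ⟨v, hv, hav, hcv⟩ :
        ∃ v, (∀ y, y = a ∨ y = b ∨ y = c ∨ y = d ∨ y = v) ∧ a ≠ v ∧ c ≠ v := by
      clear hac hbc
      revert a b c d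
      decide +kernel
    obtain ⟨x, y, hx, hy, hyv, hxy⟩ := exists_adj_of_not_isCutVertex hG (hcut v)
      (S := {a, b}) (u := a) (w := c) (by simp) (by simp [hca, hcb]) hav hcv
    have := hv y
    simp only [Set.mem_insert_iff, Set.mem_singleton_iff, not_or] at hx hy
    obtain rfl : y = d := by
      obtain rfl | h : y = c ∨ y = d := by tauto
      · rcases hx with rfl | rfl <;> contradiction
      · exact h
    rcases hx with rfl | rfl
    · exact Or.inl hxy
    · exact Or.inr hxy

theorem exists_perm_of_nodup {a b c d e : Fin 5} (h : [a, b, c, d, e].Nodup) :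
    ∃ σ : Fin 5 ≃ Fin 5, σ 0 = a ∧ σ 1 = b ∧ σ 2 = c ∧ σ 3 = d ∧ σ 4 = e := by
  have hinj : Function.Injective ![a, b, c, d, e] := by
    rw [← List.nodup_ofFn]
    simpa using h
  exact ⟨Equiv.ofBijective _ (Finite.injective_iff_bijective.1 hinj), rfl, rfl, rfl, rfl, rfl⟩

theorem IsNonseparable.comap {G : SimpleGraph (Fin 5)} (h : IsNonseparable G)
    (σ : Fin 5 ≃ Fin 5) : IsNonseparable (G.comap σ) := by
  constructor
  · intro u v
    obtain ⟨w, hwv, huw⟩ := h.1 (σ u) (σ v)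
    exact ⟨σ.symm w, fun he => hwv (by rw [← he, σ.apply_symm_apply]), by simpa using huw⟩
  · intro a b hab c hca hcb hac hbc d hda hdb hdc
    exact h.2 _ _ (σ.injective.ne hab) _ (σ.injective.ne hca) (σ.injective.ne hcb) hac hbc
      _ (σ.injective.ne hda) (σ.injective.ne hdb) (σ.injective.ne hdc)

/-- A nonseparable graph has a path on four vertices. -/
theorem IsNonseparable.exists_path {G : SimpleGraph (Fin 5)} (h : IsNonseparable G) :
    ∃ a b c d e, [a, b, c, d, e].Nodup ∧ G.Adj a b ∧ G.Adj b c ∧ G.Adj c d := by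
  obtain ⟨a, -, hba⟩ := h.1 0 0
  obtain ⟨c, hca, hbc⟩ := h.1 0 a
  obtain ⟨d, e, hnd⟩ : ∃ d e, [0, a, c, d, e].Nodup := by
    have ha := hba.ne
    have hc := hbc.ne
    clear hba hbc h
    revert a c
    decide
  simp only [List.nodup_cons, List.mem_cons, List.not_mem_nil, or_false, not_or,
    List.nodup_nil, and_true, not_false_eq_true] at hnd ⊢
  have hpair := h.2 a c hca.symm d
  by_cases had : G.Adj a d
  · exact ⟨c, 0, a, d, e, by grind, hbc.symm, hba, had⟩
  by_cases hcd : G.Adj c d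
  · exact ⟨a, 0, c, d, e, by grind, hba.symm, hbc, hcd⟩
  rcases hpair (by grind) (by grind) had hcd e (by grind) (by grind) (by grind) with hae | hce
  · exact ⟨c, 0, a, e, d, by grind, hbc.symm, hba, hae⟩
  · exact ⟨a, 0, c, e, d, by grind, hba.symm, hbc, hce⟩

/-- The graph on `Fin 5` with a path `0, 1, 2, 3` and further edges given by seven truth values. -/
def pathPlus (b₀₂ b₀₃ b₀₄ b₁₃ b₁₄ b₂₄ b₃₄ : Bool) : SimpleGraph (Fin 5) where
  Adj u v := ![![false, true, b₀₂, b₀₃, b₀₄], ![true, false, true, b₁₃, b₁₄],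
    ![b₀₂, true, false, true, b₂₄], ![b₀₃, b₁₃, true, false, b₃₄],
    ![b₀₄, b₁₄, b₂₄, b₃₄, false]] u v = true
  symm := ⟨fun u v h => by fin_cases u <;> fin_cases v <;> exact h⟩
  loopless := ⟨fun u h => by fin_cases u <;> exact Bool.noConfusion h⟩

instance (b₀₂ b₀₃ b₀₄ b₁₃ b₁₄ b₂₄ b₃₄ : Bool) :
    DecidableRel (pathPlus b₀₂ b₀₃ b₀₄ b₁₃ b₁₄ b₂₄ b₃₄).Adj :=
  fun _ _ => inferInstanceAs (Decidable (_ = true))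

theorem exists_eq_pathPlus {G : SimpleGraph (Fin 5)} (h₀₁ : G.Adj 0 1) (h₁₂ : G.Adj 1 2)
    (h₂₃ : G.Adj 2 3) :
    ∃ b₀₂ b₀₃ b₀₄ b₁₃ b₁₄ b₂₄ b₃₄, G = pathPlus b₀₂ b₀₃ b₀₄ b₁₃ b₁₄ b₂₄ b₃₄ := by
  classical
  refine ⟨decide (G.Adj 0 2), decide (G.Adj 0 3), decide (G.Adj 0 4), decide (G.Adj 1 3),
    decide (G.Adj 1 4), decide (G.Adj 2 4), decide (G.Adj 3 4), ?_⟩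
  ext u v
  fin_cases u <;> fin_cases v <;>
    simp [pathPlus, h₀₁, h₁₂, h₂₃, h₀₁.symm, h₁₂.symm, h₂₃.symm] <;> exact G.adj_comm _ _

/-- The graph has a cycle through all five vertices. -/
def HasSpanningCycle (G : SimpleGraph (Fin 5)) : Prop :=
  ∃ b, G.Adj 0 b ∧ ∃ c, G.Adj b c ∧ c ≠ 0 ∧ ∃ d, G.Adj c d ∧ d ≠ 0 ∧ d ≠ b ∧
    ∃ e, G.Adj d e ∧ G.Adj e 0 ∧ e ≠ b ∧ e ≠ c

/-- There are two vertices that form the neighborhood of every other vertex: the graph is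
`K_{2,3}` or `K_{1,1,3}`. -/
def HasTwoHubs (G : SimpleGraph (Fin 5)) : Prop :=
  ∃ x y, x ≠ y ∧ ∀ z, z ≠ x → z ≠ y → ∀ w, G.Adj z w ↔ w = x ∨ w = y

section Decidable

variable (G : SimpleGraph (Fin 5)) [DecidableRel G.Adj]

instance : Decidable (HasSpanningCycle G) := by unfold HasSpanningCycle; infer_instance

instance : Decidable (HasTwoHubs G) := by unfold HasTwoHubs; infer_instance

end Decidable
/-- The hypothesis spells out the conditions of nonseparability that are not evident from the path:
the minimum degrees of `0`, `3` and `4`, and edges between `{0, 4}` and `{2, 3}`, and between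
`{0, 1}` and `{3, 4}`. -/
theorem pathPlus_cases : ∀ b₀₂ b₀₃ b₀₄ b₁₃ b₁₄ b₂₄ b₃₄ : Bool,
    (b₀₂ || b₀₃ || b₀₄) && (b₀₃ || b₁₃ || b₃₄) &&
      (b₁₄ || b₂₄ || b₃₄) && (b₀₄ || b₂₄ || b₃₄) && (b₀₄ || b₁₄ || b₃₄) && (b₀₄ || b₁₄ || b₂₄) &&
      (b₀₂ || b₂₄ || b₀₃ || b₃₄) && (b₀₃ || b₀₄ || b₁₃ || b₁₄) →
    HasSpanningCycle (pathPlus b₀₂ b₀₃ b₀₄ b₁₃ b₁₄ b₂₄ b₃₄) ∨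
    HasTwoHubs (pathPlus b₀₂ b₀₃ b₀₄ b₁₃ b₁₄ b₂₄ b₃₄) := by
  decide +kernel

theorem IsNonseparable.cases_pathPlus {b₀₂ b₀₃ b₀₄ b₁₃ b₁₄ b₂₄ b₃₄ : Bool}
    (h : IsNonseparable (pathPlus b₀₂ b₀₃ b₀₄ b₁₃ b₁₄ b₂₄ b₃₄)) :
    HasSpanningCycle (pathPlus b₀₂ b₀₃ b₀₄ b₁₃ b₁₄ b₂₄ b₃₄) ∨
    HasTwoHubs (pathPlus b₀₂ b₀₃ b₀₄ b₁₃ b₁₄ b₂₄ b₃₄) := by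
  have h1 := h.1 0 1
  have h2 := h.1 3 2
  have h3 := h.1 4 0
  have h4 := h.1 4 1
  have h5 := h.1 4 2
  have h6 := h.1 4 3
  have h7 := fun p q => h.2 0 4 (by decide) 2 (by decide) (by decide) p q 3
    (by decide) (by decide) (by decide)
  have h8 := fun p q => h.2 0 1 (by decide) 3 (by decide) (by decide) p q 4
    (by decide) (by decide) (by decide)
  apply pathPlus_cases
  simp [pathPlus, Fin.exists_fin_succ] at h1 h2 h3 h4 h5 h6 h7 h8
  grind

/-- The adjacency matrix of the cycle `0, 1, 2, 3, 4` with the chords from `k` to `k + 2` for those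
`k` with `b k`. -/
def cyclePlus (b : Fin 5 → Bool) (u v : Fin 5) : Bool :=
  v == u + 1 || u == v + 1 || (v == u + 2 && b u) || (u == v + 2 && b v)

/-- The order of the vertices along a spanning cycle of `graphFive i`. The values for `K_{2,3}` and
`K_{1,1,3}`, which have no such cycle, are irrelevant. -/
def cycleFive : Fin 10 → Fin 5 → Fin 5 :=
  ![![0, 1, 2, 3, 4], ![0, 1, 2, 3, 4], ![0, 2, 1, 4, 3], ![0, 1, 2, 3, 4], ![0, 1, 2, 3, 4],
    ![0, 1, 2, 3, 4], ![0, 3, 1, 2, 4], ![0, 1, 2, 3, 4], ![0, 2, 1, 3, 4], ![0, 1, 2, 3, 4]]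

/-- Up to a rotation or a reflection of the cycle, every set of chords occurs in one of the ten
graphs. The second vertex is written as `u + (2 + k)` so that the chords are compared first, which
quickly discards wrong choices in the computation. -/
theorem exists_cyclePlus_eq : ∀ b₀ b₁ b₂ b₃ b₄ : Bool, ∃ i r, ∃ s : Bool, ∀ k u,
    adjFive i (cycleFive i u) (cycleFive i (u + (2 + k))) =
      cyclePlus ![b₀, b₁, b₂, b₃, b₄] (bif s then r + u else r - u)
        (bif s then r + (u + (2 + k)) else r - (u + (2 + k))) := by
  decide +kernel

/-! ### Classification up to isomorphism -/

theorem nonempty_iso_of_injective {V : Type*} [Finite V] {G H : SimpleGraph V}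
    {p q : V → V} (hp : Function.Injective p) (hq : Function.Injective q)
    (h : ∀ u v, G.Adj (p u) (p v) ↔ H.Adj (q u) (q v)) : Nonempty (G ≃g H) := by
  let p' := Equiv.ofBijective p (Finite.injective_iff_bijective.1 hp)
  let q' := Equiv.ofBijective q (Finite.injective_iff_bijective.1 hq)
  refine ⟨⟨p'.symm.trans q', fun {u v} => ?_⟩⟩
  have := h (p'.symm u) (p'.symm v)
  rw [show p (p'.symm u) = u from p'.apply_symm_apply u,
    show p (p'.symm v) = v from p'.apply_symm_apply v] at this
  exact this.symm

theorem HasSpanningCycle.exists_iso {G : SimpleGraph (Fin 5)} (h : HasSpanningCycle G) :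
    ∃ i, Nonempty (G ≃g graphFive i) := by
  classical
  obtain ⟨b, h0b, c, hbc, hc0, d, hcd, hd0, hdb, e, hde, he0, heb, hec⟩ := h
  obtain ⟨σ, h0, h1, h2, h3, h4⟩ :=
    exists_perm_of_nodup (a := 0) (b := b) (c := c) (d := d) (e := e) (by
      have := h0b.ne
      have := hbc.ne
      have := hcd.ne
      have := hde.ne
      have := he0.ne
      grind)
  set H := G.comap σ with hH
  have h01 : H.Adj 0 1 := by simpa [hH, h0, h1] using h0b
  have h12 : H.Adj 1 2 := by simpa [hH, h1, h2] using hbc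
  have h23 : H.Adj 2 3 := by simpa [hH, h2, h3] using hcd
  have h34 : H.Adj 3 4 := by simpa [hH, h3, h4] using hde
  have h40 : H.Adj 4 0 := by simpa [hH, h0, h4] using he0
  have hadj : ∀ u v, H.Adj u v ↔ cyclePlus ![decide (H.Adj 0 2), decide (H.Adj 1 3),
      decide (H.Adj 2 4), decide (H.Adj 3 0), decide (H.Adj 4 1)] u v = true := by
    intro u v
    fin_cases u <;> fin_cases v <;>
      simp [cyclePlus, h01, h12, h23, h34, h40, h01.symm, h12.symm, h23.symm, h34.symm,
        h40.symm] <;> exact H.adj_comm _ _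
  obtain ⟨i, r, s, hi⟩ := exists_cyclePlus_eq (decide (H.Adj 0 2)) (decide (H.Adj 1 3))
    (decide (H.Adj 2 4)) (decide (H.Adj 3 0)) (decide (H.Adj 4 1))
  obtain ⟨e'⟩ := nonempty_iso_of_injective (G := H) (H := graphFive i)
    (p := fun u => bif s then r + u else r - u) (q := cycleFive i)
    (by cases s <;> intro u v <;> simp) (by clear hi; revert i; decide) fun u v => by
      have := hi (v - u - 2) u
      rw [show u + (2 + (v - u - 2)) = v by abel] at this
      rw [hadj, graphFive_adj, this]
  exact ⟨i, ⟨(SimpleGraph.Iso.comap σ G).symm.trans e'⟩⟩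

theorem HasTwoHubs.exists_iso {G : SimpleGraph (Fin 5)} (h : HasTwoHubs G) :
    ∃ i, Nonempty (G ≃g graphFive i) := by
  obtain ⟨x, y, hxy, h⟩ := h
  obtain ⟨a, b, c, hnd⟩ : ∃ a b c, [x, y, a, b, c].Nodup := by
    clear h
    revert x y
    decide
  obtain ⟨σ, rfl, rfl, -⟩ := exists_perm_of_nodup hnd
  have hH : ∀ z, z ≠ 0 → z ≠ 1 → ∀ w, (G.comap σ).Adj z w ↔ w = 0 ∨ w = 1 := fun z h0 h1 w => by
    simpa using h (σ z) (σ.injective.ne h0) (σ.injective.ne h1) (σ w)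
  have hH' : ∀ z, z ≠ 0 → z ≠ 1 → ∀ w, (G.comap σ).Adj w z ↔ w = 0 ∨ w = 1 := fun z h0 h1 w => by
    rw [SimpleGraph.adj_comm, hH z h0 h1]
  have key : ∀ i, i = 1 ∨ i = 4 → ((G.comap σ).Adj 0 1 ↔ adjFive i 0 1 = true) →
      G.comap σ = graphFive i := by
    intro i hi h01
    have hi' : ∀ u v, u ≠ 0 ∧ u ≠ 1 →
        (adjFive i u v = true ↔ v = 0 ∨ v = 1) ∧ (adjFive i v u = true ↔ v = 0 ∨ v = 1) := by
      rcases hi with rfl | rfl <;> decide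
    ext u v
    rw [graphFive_adj]
    by_cases hu : u ≠ 0 ∧ u ≠ 1
    · rw [hH u hu.1 hu.2, (hi' u v hu).1]
    by_cases hv : v ≠ 0 ∧ v ≠ 1
    · rw [hH' v hv.1 hv.2, (hi' v u hv).2]
    obtain rfl | huv := eq_or_ne u v
    · rw [← graphFive_adj]
      exact iff_of_false (SimpleGraph.irrefl _) (SimpleGraph.irrefl _)
    · obtain ⟨rfl, rfl⟩ | ⟨rfl, rfl⟩ : (u = 0 ∧ v = 1) ∨ (u = 1 ∧ v = 0) := by
        have hu' : u = 0 ∨ u = 1 := by tauto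
        have hv' : v = 0 ∨ v = 1 := by tauto
        grind
      · exact h01
      · rw [SimpleGraph.adj_comm, h01, ← graphFive_adj, ← graphFive_adj, SimpleGraph.adj_comm]
  obtain ⟨i, hi⟩ : ∃ i, G.comap σ = graphFive i := by
    by_cases h01 : (G.comap σ).Adj 0 1
    · exact ⟨4, key 4 (Or.inr rfl) (iff_of_true h01 (by decide))⟩
    · exact ⟨1, key 1 (Or.inl rfl) (iff_of_false h01 (by decide))⟩
  exact ⟨i, hi ▸ ⟨(SimpleGraph.Iso.comap σ G).symm⟩⟩

theorem IsNonseparable.exists_iso {G : SimpleGraph (Fin 5)} (h : IsNonseparable G) :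
    ∃ i, Nonempty (G ≃g graphFive i) := by
  obtain ⟨a, b, c, d, e, hnd, hab, hbc, hcd⟩ := h.exists_path
  obtain ⟨σ, rfl, rfl, rfl, rfl, rfl⟩ := exists_perm_of_nodup hnd
  have hH := h.comap σ
  obtain ⟨_, _, _, _, _, _, _, heq⟩ := exists_eq_pathPlus (G := G.comap σ) hab hbc hcd
  obtain ⟨i, ⟨e⟩⟩ : ∃ i, Nonempty (G.comap σ ≃g graphFive i) := by
    rw [heq] at hH ⊢
    exact hH.cases_pathPlus.elim HasSpanningCycle.exists_iso HasTwoHubs.exists_iso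
  exact ⟨i, ⟨(SimpleGraph.Iso.comap σ G).symm.trans e⟩⟩

/-- A criterion that can be checked by computation: any two vertices are joined by a path of length
at most three that avoids any given third vertex. -/
theorem connected_and_not_isCutVertex_of_paths {V : Type*} [Finite V] {G : SimpleGraph V}
    (hV : 3 ≤ Nat.card V)
    (h : ∀ v u w, u ≠ v → w ≠ v → ∃ x, x ≠ v ∧ (u = x ∨ G.Adj u x) ∧
      ∃ y, y ≠ v ∧ (x = y ∨ G.Adj x y) ∧ (y = w ∨ G.Adj y w)) :
    G.Connected ∧ ∀ v, ¬ IsCutVertex G v := by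
  have hreach : ∀ v u w, ∀ (hu : u ≠ v) (hw : w ≠ v),
      (G.induce {x | x ≠ v}).Reachable ⟨u, hu⟩ ⟨w, hw⟩ := by
    intro v u w hu hw
    have step : ∀ {x y} (hx : x ≠ v) (hy : y ≠ v), x = y ∨ G.Adj x y →
        (G.induce {x | x ≠ v}).Reachable ⟨x, hx⟩ ⟨y, hy⟩ := by
      rintro x y hx hy (rfl | hxy)
      · rfl
      · exact SimpleGraph.Adj.reachable
          (show (G.induce {x | x ≠ v}).Adj ⟨x, hx⟩ ⟨y, hy⟩ from hxy)
    obtain ⟨x, hx, hux, y, hy, hxy, hyw⟩ := h v u w hu hw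
    exact (step hu hx hux).trans ((step hx hy hxy).trans (step hy hw hyw))
  refine ⟨?_, fun v ⟨u, w, hu, hw, _, hn⟩ => hn (hreach v u w hu hw)⟩
  have := (Nat.card_pos_iff.1 (by omega : 0 < Nat.card V)).1
  refine ⟨fun u w => ?_⟩
  obtain ⟨v, hv⟩ : ∃ v, v ∉ ({u, w} : Set V) := by
    by_contra! hcon
    have h1 := Set.ncard_le_ncard (fun x _ => hcon x : Set.univ ⊆ ({u, w} : Set V))
    have h2 := Set.ncard_insert_le u {w}
    rw [Set.ncard_univ] at h1
    rw [Set.ncard_singleton] at h2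
    omega
  simp only [Set.mem_insert_iff, Set.mem_singleton_iff, not_or] at hv
  exact (hreach v u w (Ne.symm hv.1) (Ne.symm hv.2)).map (SimpleGraph.Embedding.induce _).toHom

theorem graphFive_connected_and_not_isCutVertex (i : Fin 10) :
    (graphFive i).Connected ∧ ∀ v, ¬ IsCutVertex (graphFive i) v := by
  refine connected_and_not_isCutVertex_of_paths (by simp) ?_
  revert i
  decide +kernel

theorem isCutVertex_of_iso {V W : Type*} {G : SimpleGraph V} {H : SimpleGraph W} (e : G ≃g H)
    {v : V} (h : IsCutVertex G v) : IsCutVertex H (e v) := by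
  obtain ⟨u, w, hu, hw, hr, hn⟩ := h
  refine ⟨e u, e w, e.injective.ne hu, e.injective.ne hw, hr.map e.toHom, fun hcon => hn ?_⟩
  let φ : H.induce {x | x ≠ e v} →g G.induce {x | x ≠ v} :=
    ⟨fun x => ⟨e.symm x, fun hx => x.2 (e.symm_apply_eq.1 hx)⟩,
      fun {x y} hxy => e.symm.map_adj_iff.2 hxy⟩
  convert hcon.map φ using 1 <;> exact Subtype.ext (e.symm_apply_apply _).symm

theorem connected_and_not_isCutVertex_of_iso {V W : Type*} {G : SimpleGraph V} {H : SimpleGraph W}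
    (e : G ≃g H) (h : H.Connected ∧ ∀ v, ¬ IsCutVertex H v) :
    G.Connected ∧ ∀ v, ¬ IsCutVertex G v :=
  ⟨e.connected_iff.2 h.1, fun _ hv => h.2 _ (isCutVertex_of_iso e hv)⟩

theorem eq_of_iso_graphFive {i j : Fin 10} (e : graphFive i ≃g graphFive j) : i = j := by
  have h1 := sumChoiceNumber_congr e
  have h2 := greedyBound_congr e
  rw [sumChoiceNumber_graphFive, sumChoiceNumber_graphFive] at h1
  rw [greedyBound_graphFive, greedyBound_graphFive] at h2
  -- only `K_{1,1,3}` and the broken wheel agree in both numbers; the former has two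
  -- vertices adjacent to all others, the latter only one
  have h45 : ∀ e : graphFive 4 ≃g graphFive 5, False := fun e => by
    have hu : ∀ x, (∀ y, y ≠ x → (graphFive 4).Adj x y) → e x = 0 := by
      intro x hx
      have h5 : ∀ x, (∀ y, y ≠ x → (graphFive 5).Adj x y) → x = 0 := by decide
      refine h5 _ fun y hy => ?_
      have := e.map_adj_iff.2 (hx (e.symm y) fun h => hy (by rw [← h, e.apply_symm_apply]))
      rwa [e.apply_symm_apply] at this
    exact absurd (e.injective ((hu 0 (by decide)).trans (hu 1 (by decide)).symm)) (by decide)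
  have key : ∀ i j : Fin 10,
      (![10, 10, 11, 11, 12, 12, 13, 12, 14, 15] : Fin 10 → ℕ) i
        = (![10, 10, 11, 11, 12, 12, 13, 12, 14, 15] : Fin 10 → ℕ) j →
      (![10, 11, 11, 12, 12, 12, 13, 13, 14, 15] : Fin 10 → ℕ) i
        = (![10, 11, 11, 12, 12, 12, 13, 13, 14, 15] : Fin 10 → ℕ) j →
      i = j ∨ (i = 4 ∧ j = 5) ∨ (i = 5 ∧ j = 4) := by
    decide
  obtain h | ⟨rfl, rfl⟩ | ⟨rfl, rfl⟩ := key i j h1 h2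
  · exact h
  · exact (h45 e).elim
  · exact (h45 e.symm).elim

/-! ### Separable graphs on five vertices -/

theorem not_isChoosable_of_two_triangles {G : SimpleGraph (Fin 5)} (h01 : G.Adj 0 1)
    (h04 : G.Adj 0 4) (h14 : G.Adj 1 4) (h23 : G.Adj 2 3) (h24 : G.Adj 2 4) (h34 : G.Adj 3 4)
    {f : Fin 5 → ℕ} (hf : ∀ v, f v ≤ 2) : ¬ IsChoosable G f := by
  -- whichever color the common vertex `4` gets, it leaves one color for the rest of a triangle
  let L : Fin 5 → List ℕ := ![[0, 2], [0, 2], [1, 2], [1, 2], [0, 1]]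
  let A : Fin 5 → Fin 5 → Bool :=
    fun u v => (u, v) ∈ [((0, 1) : Fin 5 × Fin 5), (0, 4), (1, 4), (2, 3), (2, 4), (3, 4)]
  have hA : ∀ u v, A u v = true → G.Adj u v := fun u v huv => by
    simp only [A, List.mem_cons, Prod.mk.injEq, List.not_mem_nil, or_false,
      decide_eq_true_eq] at huv
    rcases huv with ⟨rfl, rfl⟩ | ⟨rfl, rfl⟩ | ⟨rfl, rfl⟩ | ⟨rfl, rfl⟩ | ⟨rfl, rfl⟩ | ⟨rfl, rfl⟩ <;>
      assumption
  have hcard : ∀ v, (L v).toFinset.card = 2 := by decide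
  exact not_isChoosable_of_listColorable_eq_false hA L (fun v => (hf v).trans (hcard v).ge)
    (by decide +kernel)

/-- If there are no edges between `{0, 1}` and `{2, 3}`, then there is a vertex of degree at most
one, or the graph consists of two triangles with the common vertex `4`. The latter graph has no
proper coloring from suitable lists of two colors each. -/
theorem isSCGreedy_of_not_adj_pairs {G : SimpleGraph (Fin 5)} (h02 : ¬ G.Adj 0 2)
    (h12 : ¬ G.Adj 1 2) (h03 : ¬ G.Adj 0 3) (h13 : ¬ G.Adj 1 3) : IsSCGreedy G := by
  classical
  rw [isSCGreedy_iff]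
  intro f hf
  by_contra! hlt
  have hfd := two_le_and_le_degree_of_sum_lt
    (fun v => isSCGreedy_of_card_le_four _ (by rw [Fintype.card_compl_set]; simp)) hf hlt
  have htwo : ∀ u x y z t, (∀ w, w = u ∨ w = x ∨ w = y ∨ w = z ∨ w = t) → ¬ G.Adj u z →
      ¬ G.Adj u t → f u = 2 ∧ G.degree u = 2 ∧ G.Adj u x ∧ G.Adj u y := by
    intro u x y z t h hz ht
    have hsub : G.neighborFinset u ⊆ {x, y} := fun w hw => by
      rw [SimpleGraph.mem_neighborFinset] at hw
      rw [Finset.mem_insert, Finset.mem_singleton]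
      obtain rfl | hx | hy | rfl | rfl := h w
      · exact absurd hw (G.irrefl)
      · exact Or.inl hx
      · exact Or.inr hy
      · exact absurd hw hz
      · exact absurd hw ht
    have h1 := hfd u
    have h2 : G.degree u ≤ 2 := (Finset.card_le_card hsub).trans Finset.card_le_two
    have heq := Finset.eq_of_subset_of_card_le hsub
      (Finset.card_le_two.trans (h1.1.trans h1.2))
    refine ⟨by omega, by omega, ?_, ?_⟩ <;> rw [← SimpleGraph.mem_neighborFinset, heq] <;> simp
  obtain ⟨f0, d0, h01, h04⟩ := htwo 0 1 4 2 3 (by decide) h02 h03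
  obtain ⟨f1, d1, -, h14⟩ := htwo 1 0 4 2 3 (by decide) h12 h13
  obtain ⟨f2, d2, h23, h24⟩ := htwo 2 3 4 0 1 (by decide) (mt .symm h02) (mt .symm h12)
  obtain ⟨f3, d3, -, h34⟩ := htwo 3 2 4 0 1 (by decide) (mt .symm h03) (mt .symm h13)
  have hE := G.sum_degrees_eq_twice_card_edges
  have hGB := greedyBound_eq_card_edgeFinset G
  have hd4 := G.degree_lt_card_verts 4
  rw [Fin.sum_univ_five] at hE hlt
  rw [Fintype.card_fin] at hGB hd4
  have f4 : f 4 ≤ 2 := by omega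
  refine not_isChoosable_of_two_triangles h01 h04 h14 h23 h24 h34 (fun v => ?_) hf
  obtain rfl | rfl | rfl | rfl | rfl : v = 0 ∨ v = 1 ∨ v = 2 ∨ v = 3 ∨ v = 4 := by
    revert v
    decide
  exacts [f0.le, f1.le, f2.le, f3.le, f4]

theorem isSCGreedy_of_not_isNonseparable {G : SimpleGraph (Fin 5)} (h : ¬ IsNonseparable G) :
    IsSCGreedy G := by
  classical
  rw [IsNonseparable, not_and_or] at h
  push Not at h
  obtain ⟨u, v, h⟩ | ⟨a, b, hab, c, hca, hcb, hac, hbc, d, hda, hdb, hdc, had, hbd⟩ := h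
  · rw [isSCGreedy_iff]
    intro f hf
    by_contra! hlt
    have hfd := two_le_and_le_degree_of_sum_lt
      (fun v => isSCGreedy_of_card_le_four _ (by rw [Fintype.card_compl_set]; simp)) hf hlt u
    have hsub : G.neighborFinset u ⊆ {v} := fun w hw => by
      by_contra hwv
      exact h w (by simpa using hwv) ((G.mem_neighborFinset u w).1 hw)
    have : G.degree u ≤ 1 := (Finset.card_le_card hsub).trans_eq (Finset.card_singleton v)
    omega
  · obtain ⟨e, he⟩ : ∃ e, [a, b, c, d, e].Nodup := by
      clear hac hbc had hbd
      revert a b c d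
      decide +kernel
    obtain ⟨σ, rfl, rfl, rfl, rfl, rfl⟩ := exists_perm_of_nodup he
    rw [← isSCGreedy_congr (SimpleGraph.Iso.comap σ G)]
    exact isSCGreedy_of_not_adj_pairs hac hbc had hbd

/-! ### Standard names -/

theorem cone_adj_some_some {V : Type*} {H : SimpleGraph V} {a b : V} :
    (cone H).Adj (some a) (some b) ↔ H.Adj a b := by
  simp only [cone, SimpleGraph.fromRel_adj]
  constructor
  · rintro ⟨-, h | h⟩
    · simpa using h
    · simpa [H.adj_comm] using h
  · intro h
    exact ⟨by simpa using h.ne, Or.inl (by simpa using h)⟩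

theorem cone_adj_none_some {V : Type*} {H : SimpleGraph V} {a : V} :
    (cone H).Adj none (some a) := by
  simp [cone]

theorem nonempty_iso_completeBipartiteGraph :
    Nonempty (graphFive 1 ≃g completeBipartiteGraph (Fin 2) (Fin 3)) := by
  refine ⟨⟨(finSumFinEquiv (m := 2) (n := 3)).symm, fun {u v} => ?_⟩⟩
  rw [graphFive_adj, completeBipartiteGraph_adj]
  revert u v
  decide

/-- A graph on `Fin (n + 1)` whose vertex `0` is adjacent to all others is a cone. -/
def isoCone {n : ℕ} {G : SimpleGraph (Fin (n + 1))} {H : SimpleGraph (Fin n)}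
    (h₀ : ∀ a : Fin n, G.Adj 0 a.succ) (h : ∀ a b : Fin n, G.Adj a.succ b.succ ↔ H.Adj a b) :
    G ≃g cone H where
  toEquiv := finSuccEquiv n
  map_rel_iff' {u v} := by
    cases u using Fin.cases <;> cases v using Fin.cases
    · simp
    · simpa [h₀] using cone_adj_none_some
    · simpa [(h₀ _).symm] using cone_adj_none_some.symm
    · simpa [h] using cone_adj_some_some

theorem nonempty_iso_brokenWheelGraph : Nonempty (graphFive 5 ≃g brokenWheelGraph 4) :=
  ⟨isoCone (by decide) (by simp only [SimpleGraph.pathGraph_adj]; decide)⟩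

theorem nonempty_iso_wheelGraph : Nonempty (graphFive 7 ≃g wheelGraph 4) :=
  ⟨isoCone (by decide) (by decide)⟩

end SumChoice

theorem mainTheorem3 {V : Type*} [Fintype V] (G : SimpleGraph V) (hV : Fintype.card V = 5) :
    -- disconnected graphs and graphs with a cut vertex are sc-greedy
    (¬ G.Connected → SumChoice.IsSCGreedy G) ∧
    ((∃ v, SumChoice.IsCutVertex G v) → SumChoice.IsSCGreedy G) ∧
    -- the remaining graphs are, up to isomorphism, the ten pairwise non-isomorphic listed ones
    ((G.Connected ∧ ∀ v, ¬ SumChoice.IsCutVertex G v) ↔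
      ∃! i : Fin 10, Nonempty (G ≃g SumChoice.graphFive i)) ∧
    -- their sum choice numbers and greedy bounds
    (∀ i : Fin 10, Nonempty (G ≃g SumChoice.graphFive i) →
      SumChoice.sumChoiceNumber G
          = (![10, 10, 11, 11, 12, 12, 13, 12, 14, 15] : Fin 10 → ℕ) i ∧
        SumChoice.greedyBound G
          = (![10, 11, 11, 12, 12, 12, 13, 13, 14, 15] : Fin 10 → ℕ) i) ∧
    -- exactly three graphs on five vertices are not sc-greedy
    (¬ SumChoice.IsSCGreedy G ↔
      Nonempty (G ≃g completeBipartiteGraph (Fin 2) (Fin 3)) ∨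
      Nonempty (G ≃g SumChoice.graphFive 3) ∨
      Nonempty (G ≃g SumChoice.wheelGraph 4)) ∧
    -- the standard names of three of the listed graphs
    Nonempty (SumChoice.graphFive 1 ≃g completeBipartiteGraph (Fin 2) (Fin 3)) ∧
    Nonempty (SumChoice.graphFive 5 ≃g SumChoice.brokenWheelGraph 4) ∧
    Nonempty (SumChoice.graphFive 7 ≃g SumChoice.wheelGraph 4) ∧
    -- explicit choice functions of sizes 11 and 12 for the two new graphs
    SumChoice.IsChoosable (SumChoice.graphFive 3) ![2, 2, 3, 2, 2] ∧
    SumChoice.IsChoosable (SumChoice.graphFive 7) ![3, 3, 2, 2, 2] := by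
  open SumChoice in
  have hval : ∀ i : Fin 10, Nonempty (G ≃g graphFive i) →
      sumChoiceNumber G = (![10, 10, 11, 11, 12, 12, 13, 12, 14, 15] : Fin 10 → ℕ) i ∧
        greedyBound G = (![10, 11, 11, 12, 12, 12, 13, 13, 14, 15] : Fin 10 → ℕ) i :=
    fun i ⟨e⟩ => ⟨by rw [sumChoiceNumber_congr e, sumChoiceNumber_graphFive],
      by rw [greedyBound_congr e, greedyBound_graphFive]⟩
  have hconn : ∀ i : Fin 10, Nonempty (G ≃g graphFive i) →
      G.Connected ∧ ∀ v, ¬ IsCutVertex G v :=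
    fun i ⟨e⟩ => connected_and_not_isCutVertex_of_iso e (graphFive_connected_and_not_isCutVertex i)
  have e₅ : G ≃g G.overFin hV := G.overFinIso hV
  have hnonsep : (G.Connected ∧ ∀ v, ¬ IsCutVertex G v) → IsNonseparable (G.overFin hV) :=
    fun h => by
      have := connected_and_not_isCutVertex_of_iso e₅.symm h
      exact isNonseparable_of_connected this.1 this.2
  have hiso : IsNonseparable (G.overFin hV) → ∃ i, Nonempty (G ≃g graphFive i) := fun h => by
    obtain ⟨i, ⟨e⟩⟩ := h.exists_iso
    exact ⟨i, ⟨e₅.trans e⟩⟩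
  have hgreedy : ¬ (∃ i, Nonempty (G ≃g graphFive i)) → IsSCGreedy G := fun h =>
    (isSCGreedy_congr e₅).2 (isSCGreedy_of_not_isNonseparable fun hn => h (hiso hn))
  obtain ⟨e₁⟩ := nonempty_iso_completeBipartiteGraph
  obtain ⟨e₇⟩ := nonempty_iso_wheelGraph
  refine ⟨fun h => hgreedy fun ⟨i, hi⟩ => h (hconn i hi).1,
    fun ⟨v, hv⟩ => hgreedy fun ⟨i, hi⟩ => (hconn i hi).2 v hv, ⟨fun h => ?_, ?_⟩, hval,
    ⟨fun h => ?_, ?_⟩, ⟨e₁⟩, nonempty_iso_brokenWheelGraph, ⟨e₇⟩,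
    isChoosable_graphFive_three, isChoosable_graphFive_seven⟩
  · obtain ⟨i, ⟨e⟩⟩ := hiso (hnonsep h)
    exact ⟨i, ⟨e⟩, fun j ⟨e'⟩ => eq_of_iso_graphFive (e'.symm.trans e)⟩
  · rintro ⟨i, hi, -⟩
    exact hconn i hi
  · obtain ⟨i, ⟨e⟩⟩ := not_imp_comm.1 hgreedy h
    rw [IsSCGreedy, (hval i ⟨e⟩).1, (hval i ⟨e⟩).2] at h
    obtain rfl | rfl | rfl : i = 1 ∨ i = 3 ∨ i = 7 := by
      clear e
      revert i
      decide
    · exact Or.inl ⟨e.trans e₁⟩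
    · exact Or.inr (Or.inl ⟨e⟩)
    · exact Or.inr (Or.inr ⟨e.trans e₇⟩)
  · have key : ∀ i : Fin 10, i = 1 ∨ i = 3 ∨ i = 7 → Nonempty (G ≃g graphFive i) →
        ¬ IsSCGreedy G := fun i hi he => by
      rw [IsSCGreedy, (hval i he).1, (hval i he).2]
      clear he
      revert i
      decide
    rintro (⟨⟨e⟩⟩ | ⟨⟨e⟩⟩ | ⟨⟨e⟩⟩)
    · exact key 1 (by decide) ⟨e.trans e₁.symm⟩
    · exact key 3 (by decide) ⟨e⟩
    · exact key 7 (by decide) ⟨e.trans e₇.symm⟩
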